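/- **Setting.** Let $S\in\{\tfrac12,1,\tfrac32,\dots\}$. For every $L\ge 1$ consider a ring of $L$ spins of length $S$ with the Hamiltonian $$H_L=V_L+\sum_{X\subseteq\{0,\dots,L-1\}}\ \sum_{x\in\mathbb Z/L}\tau_x\big(\Phi_L(X)\big).$$ Here $V_L$ is any real, translation invariant function of the operators $S^z_j$ (a longitudinal part of arbitrary range), $\Phi_L(X)$ is a self-adjoint operator on the sites of $X$ that commutes with $\sum_{j\in X}S^z_j$, and $\tau_x$ is translation by $x$. The terms $\Phi_L(X)$ are of short range, uniformly in $L$: for some $K<\infty$, all $L$ satisfy $\sum_{X\subseteq\{0,\dots,L-1\}}(|X|\max X)^2\,\|\Phi_L(X)\|\le K$ (with $\max\emptyset=0$). Thus $H_L$ is invariant under translations and under rotations about the $z$-axis; no reflection or spin-reversal symmetry and no uniqueness of lowest-energy states is assumed. The XXZ chain with transverse couplings $J(r)$, $1\le r\le L/2$, $\sum_r r^2|J(r)|<\infty$, and arbitrary longitudinal couplings and field, and chains with multi-spin or Dzyaloshinskii–Moriya interactions of finite range, are included. Let $U_{\rm trl}$ be the one-site translation. For $q\in\frac{2\pi}{L}\mathbb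 Z$ let $E_L(S^z_T;q)$ be the lowest eigenvalue of $H_L$ on the subspace with total spin $\sum_jS^z_j=S^z_T$ and $U_{\rm trl}=e^{iq}$. Fix integers $m$ and $n\ge1$ that are coprime and do not depend on $L$, and for $n\mid L$ and an integer $\Delta$ put $S^z_T=(S-m/n)L+\Delta$. Only $\Delta\ne0$ and $|S^z_T|<SL$ are considered (then every $q\in\frac{2\pi}{L}\mathbb Z$ occurs). **Theorem 3.** The lowest energy in these sectors is a continuous function of the wave number in the limit $L\to\infty$, in the following sense. 1. (No step discontinuity.) There is a constant $C$, depending only on the family $(H_L)_L$, on $m$ and on $n$, such that for all $L$ and $\Delta$ as above, every $q\in\frac{2\pi}{L}\mathbb Z$, and every $W$ with $E_L(S^z_T;q')-E_L(S^z_T;q'')\le W$ for all $q',q''\in\frac{2\pi}{L}\mathbb Z$, $$\Big|E_L\big(S^z_T;q+\tfrac{2\pi n\Delta}{L}\big)-E_L(S^z_T;q)\Big|^2\le \frac{C\,W}{L}.$$ 2. (Continuity of the limit.) Let $L_i\to\infty$ with $n\mid L_i$, and let $\Delta_i\neq0$ be integers with $\Delta_i/L_i\to0$ (for instance $\Delta_i=\Delta$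 fixed) such that $S_i=(S-m/n)L_i+\Delta_i$ satisfies $|S_i|<SL_i$. Suppose that, for some real numbers $c_i$ and some $a_i\in[0,1]$, the dispersion curves $$q\longmapsto E_{L_i}\Big(S_i;\ \tfrac{2\pi}{L_i}\Big\lfloor \tfrac{qL_i}{2\pi}+a_i\Big\rfloor\Big)-c_i\qquad(q\in\mathbb R)$$ converge uniformly on $\mathbb R$ to a function $e(q)$. Then $e$ is continuous. -/

import Mathlib

/-- A basis state of a periodic chain of `L` spins of length `S = d / 2`: the site `j` carries
the eigenvector of `S^z_j` with eigenvalue `S - σ j`, where `σ j ∈ {0, …, 2 S}`. -/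
abbrev Config (d L : ℕ) : Type := ZMod L → Fin (d + 1)

/-- The eigenvalue of the total spin `S^z_T = ∑ j, S^z_j` on the basis state `σ`. -/
noncomputable def totalSpinZ {d L : ℕ} [NeZero L] (σ : Config d L) : ℝ :=
  ∑ j : ZMod L, ((d : ℝ) / 2 - ((σ j : ℕ) : ℝ))

/-- The one-site translation `U_trl`, with `U_trl† S_j U_trl = S_{j+1}`: it maps the basis state
`σ` to `fun j => σ (j + 1)`, hence acts on wave functions as follows. -/
def translateState {d L : ℕ} (ψ : Config d L → ℂ) : Config d L → ℂ :=
  fun σ => ψ (fun j => σ (j - 1))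

/-- The subspace (written as a predicate on wave functions) with total spin `S^z_T = M` and
wave number `q`, i.e. `U_trl ψ = exp (i q) ψ`. -/
def InSector {d L : ℕ} [NeZero L] (M q : ℝ) (ψ : Config d L → ℂ) : Prop :=
  (∀ σ, ψ σ ≠ 0 → totalSpinZ σ = M) ∧
    translateState ψ = Complex.exp (Complex.I * (q : ℂ)) • ψ

/-- The lowest energy `E(M; q)` of the Hamiltonian `A`: the least eigenvalue of `A` that has an
eigenvector in the subspace with total spin `M` and wave number `q`. -/
noncomputable def lowestEnergy {d L : ℕ} [NeZero L] (A : Matrix (Config d L) (Config d L) ℂ)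
    (M q : ℝ) : ℝ :=
  sInf {E : ℝ | ∃ ψ : Config d L → ℂ, ψ ≠ 0 ∧ InSector M q ψ ∧ A.mulVec ψ = (E : ℂ) • ψ}

/-- The operator `h`, given on the sites of a finite set `X` of offsets, placed on the sites
`x + X` of the ring and acting as the identity on all other sites. -/
noncomputable def placeAt {d L : ℕ} (x : ZMod L) {X : Finset ℕ}
    (h : Matrix (X → Fin (d + 1)) (X → Fin (d + 1)) ℂ) : Matrix (Config d L) (Config d L) ℂ :=
  open Classical in
  Matrix.of fun σ τ =>
    if ∀ y : ZMod L, (∀ j ∈ X, y ≠ x + (j : ZMod L)) → σ y = τ y then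
      h (fun j => σ (x + ((j : ℕ) : ZMod L))) (fun j => τ (x + ((j : ℕ) : ZMod L)))
    else 0

/-- A translation invariant, `U(1)` invariant spin chain of spin `S = d / 2`, for every system
size `L`: an arbitrary (possibly long-range) translation invariant longitudinal part, diagonal in
the `S^z` basis, together with multi-site terms `term L X`, one for each set `X` of offsets, which
are self-adjoint and conserve the total `S^z`. -/
structure SpinChain (d : ℕ) where
  diag : (L : ℕ) → Config d L → ℝ
  diag_translate : ∀ (L : ℕ) (σ : Config d L), diag L (fun j => σ (j - 1)) = diag L σ
  term : (L : ℕ) → (X : Finset ℕ) → Matrix (X → Fin (d + 1)) (X → Fin (d + 1)) ℂ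
  term_isHermitian : ∀ (L : ℕ) (X : Finset ℕ), (term L X).IsHermitian
  term_conserves : ∀ (L : ℕ) (X : Finset ℕ) (σ τ : X → Fin (d + 1)),
    term L X σ τ ≠ 0 → ∑ j, ((σ j : ℕ)) = ∑ j, ((τ j : ℕ))

/-- The Hamiltonian on the periodic chain of `L` sites: the longitudinal part plus all
translates of the terms with offsets in `{0, …, L - 1}`. -/
noncomputable def SpinChain.hamiltonian {d : ℕ} (H : SpinChain d) (L : ℕ) [NeZero L] :
    Matrix (Config d L) (Config d L) ℂ :=
  Matrix.diagonal (fun σ => ((H.diag L σ : ℝ) : ℂ)) +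
    ∑ X ∈ (Finset.range L).powerset, ∑ x : ZMod L, placeAt x (H.term L X)

/-- Short range of the non-longitudinal terms, uniformly in `L`: the number of sites times the
extent of `X` has a finite second moment with respect to the operator norms of the terms.
For a transverse two-spin coupling `J r` this says that `∑ r, r ^ 2 * |J r|` is finite; terms of
bounded range, or decaying exponentially with the range, are covered. -/
def SpinChain.ShortRange {d : ℕ} (H : SpinChain d) : Prop :=
  ∃ K : ℝ, ∀ L : ℕ, ∑ X ∈ (Finset.range L).powerset,
    ((X.card : ℝ) * ((X.sup id : ℕ) : ℝ)) ^ 2 *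
      ‖Matrix.toEuclideanCLM (n := X → Fin (d + 1)) (𝕜 := ℂ) (H.term L X)‖ ≤ K

/-- The total spin `S^z_T = (S - m / n) L + δ` of the sector, with `S = d / 2`. -/
noncomputable def sectorSpin (d : ℕ) (m : ℤ) (n L : ℕ) (δ : ℤ) : ℝ :=
  ((d : ℝ) / 2 - (m : ℝ) / (n : ℝ)) * (L : ℝ) + (δ : ℝ)

/-- The lowest energy of the chain of `L` sites in the sector `S^z_T = M`, at the allowed wave
number `q = 2 π p / L`. -/
noncomputable def SpinChain.energy {d : ℕ} (H : SpinChain d) (L : ℕ) [NeZero L] (M : ℝ) (p : ℤ) :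
    ℝ :=
  lowestEnergy (H.hamiltonian L) M (2 * Real.pi * (p : ℝ) / (L : ℝ))

/-! The engine is the Lieb–Schultz–Mattis twist, the diagonal unitary `U = exp(2πi n/L ∑ j σ_j)`. On
the sector, `n ∑ σ_j ≡ -n δ` modulo `L`, so conjugation by a translation multiplies `U` by a
constant phase: `U` and `U†` shift the wave number index `p` by `∓ n δ` (`twist_mul_mem_sector`,
`star_twist_mul_mem_sector`). Twisting a lowest eigenvector both ways gives trial states on both
sides of `p`. The sum of their energies minus twice the original one is the expectation of a double
commutator. The longitudinal part drops out of it, and each of the `L` translates of a short-range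
term costs `O(1/L²)`, so the second difference of the energy along `p + k n δ` is at most `O(1/L)`
(`SpinChain.energy_semiconcave`). Adding the two twists cancels the first-order term, which replaces
any reflection symmetry.

A sequence of total variation range `W` whose second differences are at most `c` has increments `D`
with `D² ≤ 2cW`: a steep step would persist backwards for about `D/c` steps. This is the first
claim.

For the second, uniform convergence bounds the curves uniformly, so their change under the shift `n
δ` vanishes. At one fixed `i` the curve is constant on either side of a point, so the limit can only
jump there; a later, much finer shift straddles the point and excludes the jump. -/

/-! ### Least eigenvalues of symmetric operators on invariant subspaces. -/

section Variational

variable {V : Type*} [NormedAddCommGroup V] [InnerProductSpace ℂ V] [FiniteDimensional ℂ V]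

theorem LinearMap.IsSymmetric.exists_eigenvalue_le_rayleigh [Nontrivial V] {T : V →ₗ[ℂ] V}
    (hT : T.IsSymmetric) :
    ∃ E : ℝ, (∃ v : V, v ≠ 0 ∧ T v = (E : ℂ) • v) ∧
      ∀ v : V, E * ‖v‖ ^ 2 ≤ (inner ℂ v (T v)).re := by
  have hev := hT.hasEigenvalue_iInf_of_finiteDimensional
  refine ⟨⨅ x : {x : V // x ≠ 0}, RCLike.re (inner ℂ (T x) (x : V)) / ‖(x : V)‖ ^ 2, ?_,
    fun v => ?_⟩
  · obtain ⟨v, hv⟩ := hev.exists_hasEigenvector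
    exact ⟨v, hv.2, hv.apply_eq_smul⟩
  · by_cases hv0 : v = 0
    · simp [hv0]
    -- A real `⨅` is a lower bound only if the family is bounded below; the operator norm provides
    -- this.
    have hbdd : BddBelow (Set.range fun x : {x : V // x ≠ 0} =>
        RCLike.re (inner ℂ (T x) (x : V)) / ‖(x : V)‖ ^ 2) := by
      refine ⟨-‖LinearMap.toContinuousLinearMap T‖, ?_⟩
      rintro _ ⟨x, rfl⟩
      have hx : 0 < ‖(x : V)‖ := norm_pos_iff.2 x.2
      have h1 : |RCLike.re (inner ℂ (T x) (x : V))| ≤ ‖T x‖ * ‖(x : V)‖ :=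
        (RCLike.abs_re_le_norm _).trans (norm_inner_le_norm _ _)
      have h2 : ‖T x‖ ≤ ‖LinearMap.toContinuousLinearMap T‖ * ‖(x : V)‖ :=
        (LinearMap.toContinuousLinearMap T).le_opNorm x
      rw [le_div_iff₀ (by positivity)]
      nlinarith [(abs_le.1 h1).1]
    have hpos : 0 < ‖v‖ := norm_pos_iff.2 hv0
    rw [← le_div_iff₀ (by positivity), ← hT v v]
    exact ciInf_le hbdd ⟨v, hv0⟩

theorem LinearMap.IsSymmetric.exists_least_eigenvalue {T : V →ₗ[ℂ] V}
    (hT : T.IsSymmetric) (W : Submodule ℂ V) (hW : ∀ v ∈ W, T v ∈ W) (hne : ∃ v ∈ W, v ≠ 0) :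
    ∃ E : ℝ, (∃ v ∈ W, v ≠ 0 ∧ T v = (E : ℂ) • v) ∧
      ∀ v ∈ W, E * ‖v‖ ^ 2 ≤ (inner ℂ v (T v)).re := by
  obtain ⟨v₀, hv₀, hv₀'⟩ := hne
  have : Nontrivial W := ⟨⟨⟨v₀, hv₀⟩, 0, fun h => hv₀' (congrArg Subtype.val h)⟩⟩
  have hR : (T.restrict hW).IsSymmetric := fun v w => hT v w
  obtain ⟨E, ⟨v, hv, hEv⟩, hlow⟩ := hR.exists_eigenvalue_le_rayleigh
  refine ⟨E, ⟨v, v.2, fun h => hv (Subtype.ext h), congrArg Subtype.val hEv⟩, fun w hw => ?_⟩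
  exact hlow ⟨w, hw⟩

end Variational

/-! ### Expectation values of matrices. -/

section QuadraticForm

variable {ι : Type*} [Fintype ι]

/-- The expectation value of the operator `A` in the (not necessarily normalized) state `ψ`. -/
noncomputable def expectation (A : Matrix ι ι ℂ) (ψ : ι → ℂ) : ℝ :=
  (star ψ ⬝ᵥ A.mulVec ψ).re

/-- The squared norm of the state `ψ`. -/
noncomputable def sqNorm (ψ : ι → ℂ) : ℝ :=
  ∑ i, ‖ψ i‖ ^ 2

theorem sqNorm_eq_norm_toLp (ψ : ι → ℂ) : sqNorm ψ = ‖WithLp.toLp 2 ψ‖ ^ 2 := by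
  simp [sqNorm, EuclideanSpace.norm_sq_eq]

theorem expectation_eq_sum (A : Matrix ι ι ℂ) (ψ : ι → ℂ) :
    expectation A ψ = (∑ i, ∑ j, star (ψ i) * A i j * ψ j).re := by
  simp [expectation, dotProduct, Matrix.mulVec, Finset.mul_sum, mul_assoc]

theorem expectation_sum {κ : Type*} (s : Finset κ) (A : κ → Matrix ι ι ℂ) (ψ : ι → ℂ) :
    expectation (∑ k ∈ s, A k) ψ = ∑ k ∈ s, expectation (A k) ψ := by
  simp [expectation, Matrix.sum_mulVec, dotProduct_sum]

theorem expectation_of_eigenvector {A : Matrix ι ι ℂ} {ψ : ι → ℂ} {E : ℝ}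
    (h : A.mulVec ψ = (E : ℂ) • ψ) : expectation A ψ = E * sqNorm ψ := by
  have : star ψ ⬝ᵥ ψ = (sqNorm ψ : ℂ) := by
    simp [dotProduct, sqNorm, Complex.conj_mul']
  rw [expectation, h, dotProduct_smul, this, smul_eq_mul, ← Complex.ofReal_mul,
    Complex.ofReal_re]

theorem expectation_eq_inner [DecidableEq ι] (A : Matrix ι ι ℂ) (ψ : ι → ℂ) :
    expectation A ψ =
      (inner ℂ (WithLp.toLp 2 ψ)
        (Matrix.toEuclideanCLM (n := ι) (𝕜 := ℂ) A (WithLp.toLp 2 ψ))).re := by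
  rw [Matrix.toEuclideanCLM_toLp, EuclideanSpace.inner_toLp_toLp, dotProduct_comm]
  rfl

theorem expectation_le_opNorm [DecidableEq ι] (A : Matrix ι ι ℂ) (ψ : ι → ℂ) :
    expectation A ψ ≤ ‖Matrix.toEuclideanCLM (n := ι) (𝕜 := ℂ) A‖ * sqNorm ψ := by
  rw [expectation_eq_inner, sqNorm_eq_norm_toLp]
  refine (Complex.re_le_norm _).trans ((norm_inner_le_norm _ _).trans ?_)
  have := (Matrix.toEuclideanCLM (n := ι) (𝕜 := ℂ) A).le_opNorm (WithLp.toLp 2 ψ)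
  nlinarith [norm_nonneg (WithLp.toLp 2 ψ)]

theorem sqNorm_pos {ψ : ι → ℂ} (h : ψ ≠ 0) : 0 < sqNorm ψ := by
  rw [sqNorm_eq_norm_toLp]
  have : WithLp.toLp 2 ψ ≠ 0 := by simpa using h
  positivity

/-- The variational principle: a Hermitian matrix has a least eigenvalue on each nonzero
invariant subspace, and it bounds the quadratic form from below. -/
theorem Matrix.IsHermitian.exists_isLeast_eigenvalue {A : Matrix ι ι ℂ} (hA : A.IsHermitian)
    (W : Submodule ℂ (ι → ℂ)) (hW : ∀ ψ ∈ W, A.mulVec ψ ∈ W) (hne : ∃ ψ ∈ W, ψ ≠ 0) :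
    ∃ E : ℝ, IsLeast {E : ℝ | ∃ ψ : ι → ℂ, ψ ≠ 0 ∧ ψ ∈ W ∧ A.mulVec ψ = (E : ℂ) • ψ} E ∧
      ∀ φ ∈ W, E * sqNorm φ ≤ expectation A φ := by
  classical
  let W' : Submodule ℂ (EuclideanSpace ℂ ι) := W.comap (WithLp.linearEquiv 2 ℂ (ι → ℂ)).toLinearMap
  obtain ⟨ψ₀, hψ₀, hψ₀'⟩ := hne
  obtain ⟨E, ⟨v, hvW, hv0, hv⟩, hlow'⟩ :=
    (Matrix.isSymmetric_toEuclideanLin_iff.2 hA).exists_least_eigenvalue W'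
      (fun v hv => hW v.ofLp hv) ⟨WithLp.toLp 2 ψ₀, hψ₀, by simpa using hψ₀'⟩
  have hlow : ∀ φ ∈ W, E * sqNorm φ ≤ expectation A φ := by
    intro φ hφ
    rw [sqNorm_eq_norm_toLp, expectation_eq_inner]
    exact hlow' (WithLp.toLp 2 φ) hφ
  refine ⟨E, ⟨⟨v.ofLp, by simpa using hv0, hvW, congrArg WithLp.ofLp hv⟩, ?_⟩, hlow⟩
  rintro E' ⟨ψ, hψ, hψW, hEψ⟩
  have := hlow ψ hψW
  rw [expectation_of_eigenvector hEψ] at this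
  exact le_of_mul_le_mul_right this (sqNorm_pos hψ)

end QuadraticForm

/-! ### Diagonal twists and the double commutator. -/

section Twist

variable {ι : Type*}

/-- The weights by which the matrix elements of `A` get multiplied in `U† A U + U A U† - 2 A`,
where `U` is the diagonal unitary with entries `u`. -/
def twistKernel (u : ι → ℂ) : Matrix ι ι ℂ :=
  Matrix.of fun i j => star (u i) * u j + u i * star (u j) - 2

theorem expectation_twist [Fintype ι] (A : Matrix ι ι ℂ) (u ψ : ι → ℂ) :
    expectation A (u * ψ) + expectation A (star u * ψ) - 2 * expectation A ψ =
      expectation (A.hadamard (twistKernel u)) ψ := by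
  have h2 : 2 * expectation A ψ = (2 * ∑ i, ∑ j, star (ψ i) * A i j * ψ j).re := by
    rw [expectation_eq_sum]; simp
  rw [h2]
  simp only [expectation_eq_sum, ← Complex.add_re, ← Complex.sub_re, Finset.mul_sum,
    ← Finset.sum_add_distrib, ← Finset.sum_sub_distrib]
  congr 1
  refine Finset.sum_congr rfl fun i _ => Finset.sum_congr rfl fun j _ => ?_
  simp [twistKernel]
  ring

open scoped Matrix.Norms.L2Operator in
/-- The double commutator bound. -/
theorem opNorm_hadamard_twistKernel_le [Fintype ι] [DecidableEq ι] (h : Matrix ι ι ℂ) (v : ι → ℂ)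
    (hv : ∀ i, v i * star (v i) = 1) {r : ℝ} (hr : 0 ≤ r) (hvr : ∀ i, ‖v i - 1‖ ≤ r) :
    ‖Matrix.toEuclideanCLM (n := ι) (𝕜 := ℂ) (h.hadamard (twistKernel v))‖ ≤
      4 * r ^ 2 * ‖Matrix.toEuclideanCLM (n := ι) (𝕜 := ℂ) h‖ := by
  rw [Matrix.l2_opNorm_toEuclideanCLM, Matrix.l2_opNorm_toEuclideanCLM]
  set D : Matrix ι ι ℂ := Matrix.diagonal fun i => v i - 1 with hD
  set D' : Matrix ι ι ℂ := Matrix.diagonal fun i => star (v i) - 1 with hD'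
  -- Subtracting the identity from `v` and `star v` leaves the commutators unchanged and makes both
  -- factors of size `r`.
  have key : h.hadamard (twistKernel v) = D' * (h * D - D * h) - (h * D - D * h) * D' := by
    ext i j
    simp only [Matrix.hadamard_apply, twistKernel, Matrix.of_apply, Matrix.sub_apply, hD, hD',
      Matrix.diagonal_mul, Matrix.mul_diagonal]
    linear_combination h i j * hv i + h i j * hv j
  have hDn : ‖D‖ ≤ r := by
    rw [hD, Matrix.l2_opNorm_diagonal]
    exact (pi_norm_le_iff_of_nonneg hr).2 hvr
  have hDn' : ‖D'‖ ≤ r := by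
    rw [hD', Matrix.l2_opNorm_diagonal]
    refine (pi_norm_le_iff_of_nonneg hr).2 fun i => ?_
    rw [← star_one ℂ, ← star_sub, norm_star]
    exact hvr i
  have hcomm : ‖h * D - D * h‖ ≤ 2 * r * ‖h‖ := by
    refine (norm_sub_le _ _).trans ?_
    have h1 := norm_mul_le h D
    have h2 := norm_mul_le D h
    nlinarith [norm_nonneg h]
  rw [key]
  refine (norm_sub_le _ _).trans ?_
  have h1 := norm_mul_le D' (h * D - D * h)
  have h2 := norm_mul_le (h * D - D * h) D'
  have h3 : ‖D'‖ * ‖h * D - D * h‖ ≤ r * (2 * r * ‖h‖) := by gcongr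
  nlinarith

/-- An operator acting on one tensor factor, the identity on the other, has quadratic form
bounded by its norm. -/
theorem expectation_tensor_one_le [Fintype ι] {α β : Type*} [Fintype α] [Fintype β]
    [DecidableEq α] [DecidableEq β] (f : ι → α) (r : ι → β)
    (hfr : Function.Bijective fun i => (f i, r i)) (g : Matrix α α ℂ) (ψ : ι → ℂ) :
    expectation (Matrix.of fun i j => if r i = r j then g (f i) (f j) else 0) ψ ≤
      ‖Matrix.toEuclideanCLM (n := α) (𝕜 := ℂ) g‖ * sqNorm ψ := by
  let e : ι ≃ α × β := Equiv.ofBijective _ hfr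
  have hf : ∀ a b, f (e.symm (a, b)) = a := fun a b =>
    congrArg Prod.fst (e.apply_symm_apply (a, b))
  have hr : ∀ a b, r (e.symm (a, b)) = b := fun a b =>
    congrArg Prod.snd (e.apply_symm_apply (a, b))
  have h1 : expectation (Matrix.of fun i j => if r i = r j then g (f i) (f j) else 0) ψ =
      ∑ b, expectation g (fun a => ψ (e.symm (a, b))) := by
    simp only [expectation_eq_sum]
    rw [← Complex.re_sum]
    congr 1
    rw [← e.symm.sum_comp, Fintype.sum_prod_type_right]
    refine Finset.sum_congr rfl fun b _ => Finset.sum_congr rfl fun a _ => ?_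
    rw [← e.symm.sum_comp, Fintype.sum_prod_type]
    refine Finset.sum_congr rfl fun a' _ => ?_
    simp [hf, hr]
  have h2 : sqNorm ψ = ∑ b, sqNorm (fun a => ψ (e.symm (a, b))) := by
    simp only [sqNorm]
    rw [← e.symm.sum_comp, Fintype.sum_prod_type_right]
  rw [h1, h2, Finset.mul_sum]
  exact Finset.sum_le_sum fun b _ => expectation_le_opNorm _ _

end Twist

/-! ### Increments of semiconcave sequences. -/

section Sequence

/-- Going backwards from the step `D`, increments shrink by at most `c` each, so about `D / c` of
them add up to about `D² / (2c)`, which `W` must exceed. -/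
theorem increment_sq_le_of_semiconcave_of_nonneg {a : ℤ → ℝ} {c W : ℝ} (hc : 0 < c)
    (ha : ∀ k, a (k + 1) + a (k - 1) - 2 * a k ≤ c) (hW : ∀ k l, a k - a l ≤ W)
    (hD : 0 ≤ a 1 - a 0) : (a 1 - a 0) ^ 2 ≤ 2 * c * W := by
  set D := a 1 - a 0 with hDdef
  have hinc : ∀ j : ℕ, D - j * c ≤ a (1 - j) - a (-j) := by
    intro j
    induction j with
    | zero => simp [hDdef]
    | succ j ih =>
      have := ha (-j)
      push_cast
      rw [show (1 : ℤ) - (j + 1) = -j by ring, show -((j : ℤ) + 1) = -j - 1 by ring]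
      rw [show -(j : ℤ) + 1 = 1 - j by ring] at this
      linarith
  have hsum : ∀ j : ℕ, j * D - c * j * (j - 1) / 2 ≤ a 1 - a (1 - j) := by
    intro j
    induction j with
    | zero => simp
    | succ j ih =>
      have := hinc j
      push_cast
      rw [show (1 : ℤ) - (j + 1) = -j by ring]
      linarith
  -- With `J = ⌊D / c⌋₊`, the sum of `J + 1` increments is at least `(J + 1) D / 2`, and `(J + 1) c
  -- ≥ D`.
  have h1 := (hsum (⌊D / c⌋₊ + 1)).trans (hW _ _)
  have h2 : (⌊D / c⌋₊ : ℝ) * c ≤ D := (le_div_iff₀ hc).1 (Nat.floor_le (by positivity))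
  have h3 : D ≤ (⌊D / c⌋₊ + 1 : ℝ) * c := (div_le_iff₀ hc).1 (Nat.lt_floor_add_one (D / c)).le
  push_cast at h1
  set J : ℝ := ((⌊D / c⌋₊ : ℕ) : ℝ)
  have hJ : 0 ≤ J := Nat.cast_nonneg _
  have h4 : (J + 1) * D / 2 ≤ W := by nlinarith
  nlinarith

/-- A bounded sequence with second differences bounded above has small increments. -/
theorem increment_sq_le_of_semiconcave {a : ℤ → ℝ} {c W : ℝ} (hc : 0 < c)
    (ha : ∀ k, a (k + 1) + a (k - 1) - 2 * a k ≤ c) (hW : ∀ k l, a k - a l ≤ W) :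
    (a 1 - a 0) ^ 2 ≤ 2 * c * W := by
  rcases le_total 0 (a 1 - a 0) with h | h
  · exact increment_sq_le_of_semiconcave_of_nonneg hc ha hW h
  -- The reflection `k ↦ 1 - k` keeps second differences and reverses the sign of the increment.
  · have := increment_sq_le_of_semiconcave_of_nonneg (a := fun k => a (1 - k)) (W := W) hc
      (fun k => by
        have := ha (1 - k)
        rw [show (1 : ℤ) - (k + 1) = 1 - k - 1 by ring, show (1 : ℤ) - (k - 1) = 1 - k + 1 by ring]
        linarith) (fun k l => hW _ _) (by norm_num; linarith)
    norm_num at this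
    linarith [sq_abs (a 1 - a 0), sub_sq_comm (a 0) (a 1)]

end Sequence

/-! ### Local operators placed on the ring. -/

section Placement

variable {d L : ℕ}

theorem injective_add_offset {X : Finset ℕ} (hX : X ⊆ Finset.range L) (x : ZMod L) :
    Function.Injective fun j : X => x + ((j : ℕ) : ZMod L) := by
  intro i j hij
  have h := add_left_cancel hij
  rw [ZMod.natCast_eq_natCast_iff'] at h
  rw [Nat.mod_eq_of_lt (Finset.mem_range.1 (hX i.2)),
    Nat.mod_eq_of_lt (Finset.mem_range.1 (hX j.2))] at h
  exact Subtype.ext h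

theorem placeAt_apply_of_agree {x : ZMod L} {X : Finset ℕ}
    (h : Matrix (X → Fin (d + 1)) (X → Fin (d + 1)) ℂ) {σ τ : Config d L}
    (hστ : ∀ y : ZMod L, (∀ j ∈ X, y ≠ x + (j : ZMod L)) → σ y = τ y) :
    placeAt x h σ τ = h (fun j => σ (x + ((j : ℕ) : ZMod L))) (fun j => τ (x + ((j : ℕ) : ZMod L))) :=
  if_pos hστ

theorem placeAt_apply_of_not_agree {x : ZMod L} {X : Finset ℕ}
    (h : Matrix (X → Fin (d + 1)) (X → Fin (d + 1)) ℂ) {σ τ : Config d L}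
    (hστ : ¬ ∀ y : ZMod L, (∀ j ∈ X, y ≠ x + (j : ZMod L)) → σ y = τ y) :
    placeAt x h σ τ = 0 :=
  if_neg hστ

theorem placeAt_isHermitian {X : Finset ℕ} {h : Matrix (X → Fin (d + 1)) (X → Fin (d + 1)) ℂ}
    (hh : h.IsHermitian) (x : ZMod L) : (placeAt x h).IsHermitian := by
  ext σ τ
  rw [Matrix.conjTranspose_apply]
  by_cases hστ : ∀ y : ZMod L, (∀ j ∈ X, y ≠ x + (j : ZMod L)) → σ y = τ y
  · rw [placeAt_apply_of_agree h hστ, placeAt_apply_of_agree h fun y hy => (hστ y hy).symm,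
      hh.apply]
  · rw [placeAt_apply_of_not_agree h hστ,
      placeAt_apply_of_not_agree h fun H => hστ fun y hy => (H y hy).symm, star_zero]

theorem placeAt_translate {X : Finset ℕ} (h : Matrix (X → Fin (d + 1)) (X → Fin (d + 1)) ℂ)
    (x : ZMod L) (σ τ : Config d L) :
    placeAt x h (fun j => σ (j - 1)) (fun j => τ (j - 1)) = placeAt (x - 1) h σ τ := by
  have hiff : (∀ y : ZMod L, (∀ j ∈ X, y ≠ x + (j : ZMod L)) → σ (y - 1) = τ (y - 1)) ↔
      ∀ y : ZMod L, (∀ j ∈ X, y ≠ x - 1 + (j : ZMod L)) → σ y = τ y := by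
    constructor
    · intro H y hy
      have := H (y + 1) fun j hj h => hy j hj (by linear_combination h)
      simpa using this
    · intro H y hy
      exact H (y - 1) fun j hj h => hy j hj (by linear_combination h)
  by_cases hστ : ∀ y : ZMod L, (∀ j ∈ X, y ≠ x - 1 + (j : ZMod L)) → σ y = τ y
  · rw [placeAt_apply_of_agree h hστ, placeAt_apply_of_agree h (hiff.2 hστ)]
    simp only [add_sub_right_comm]
  · rw [placeAt_apply_of_not_agree h hστ, placeAt_apply_of_not_agree h (mt hiff.1 hστ)]

variable [NeZero L]

theorem sum_sub_sum_of_agree {G : Type*} [AddCommGroup G] {X : Finset ℕ}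
    (hX : X ⊆ Finset.range L) {x : ZMod L} {σ τ : Config d L}
    (hστ : ∀ y : ZMod L, (∀ j ∈ X, y ≠ x + (j : ZMod L)) → σ y = τ y)
    (f : ZMod L → Fin (d + 1) → G) :
    ∑ y, f y (σ y) - ∑ y, f y (τ y) =
      ∑ j : X, (f (x + ((j : ℕ) : ZMod L)) (σ (x + ((j : ℕ) : ZMod L))) -
        f (x + ((j : ℕ) : ZMod L)) (τ (x + ((j : ℕ) : ZMod L)))) := by
  rw [← Finset.sum_sub_distrib]
  symm
  refine Fintype.sum_of_injective _ (injective_add_offset hX x) _ _ (fun y hy => ?_) fun _ => rfl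
  rw [hστ y fun j hj h => hy ⟨⟨j, hj⟩, h.symm⟩, sub_self]

theorem totalSpinZ_eq (σ : Config d L) :
    totalSpinZ σ = (d : ℝ) / 2 * L - ((∑ j, (σ j : ℕ) : ℕ) : ℝ) := by
  simp [totalSpinZ, Finset.sum_sub_distrib, mul_comm]

theorem placeAt_conserves {X : Finset ℕ} (hX : X ⊆ Finset.range L)
    {h : Matrix (X → Fin (d + 1)) (X → Fin (d + 1)) ℂ}
    (hc : ∀ s t, h s t ≠ 0 → ∑ j, (s j : ℕ) = ∑ j, (t j : ℕ)) {x : ZMod L} {σ τ : Config d L}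
    (hne : placeAt x h σ τ ≠ 0) : totalSpinZ σ = totalSpinZ τ := by
  by_cases hστ : ∀ y : ZMod L, (∀ j ∈ X, y ≠ x + (j : ZMod L)) → σ y = τ y
  · rw [placeAt_apply_of_agree h hστ] at hne
    have h1 := congrArg (Nat.cast : ℕ → ℝ) (hc _ _ hne)
    have h2 := sum_sub_sum_of_agree hX hστ fun _ s => ((s : ℕ) : ℝ)
    rw [totalSpinZ_eq, totalSpinZ_eq]
    push_cast at h1 ⊢
    rw [Finset.sum_sub_distrib] at h2
    linarith
  · exact absurd (placeAt_apply_of_not_agree h hστ) hne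

/-- A configuration is a pair of restrictions, to `x + X` and to its complement, and the placed
operator is `g` tensored with the identity. -/
theorem expectation_placeAt_le {X : Finset ℕ} (hX : X ⊆ Finset.range L)
    (g : Matrix (X → Fin (d + 1)) (X → Fin (d + 1)) ℂ) (x : ZMod L) (ψ : Config d L → ℂ) :
    expectation (placeAt x g) ψ ≤
      ‖Matrix.toEuclideanCLM (n := X → Fin (d + 1)) (𝕜 := ℂ) g‖ * sqNorm ψ := by
  classical
  let P : ZMod L → Prop := fun y => ∀ j ∈ X, y ≠ x + (j : ZMod L)
  let f : Config d L → X → Fin (d + 1) := fun σ j => σ (x + ((j : ℕ) : ZMod L))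
  let r : Config d L → {y // P y} → Fin (d + 1) := fun σ y => σ y
  have hP : ∀ y, ¬ P y → ∃ j : X, x + ((j : ℕ) : ZMod L) = y := by
    intro y hy
    simp only [P, not_forall, not_not] at hy
    obtain ⟨j, hj, h⟩ := hy
    exact ⟨⟨j, hj⟩, h.symm⟩
  have hfr : Function.Bijective fun σ => (f σ, r σ) := by
    constructor
    · intro σ τ hστ
      obtain ⟨h1, h2⟩ := Prod.mk.inj hστ
      funext y
      by_cases hy : P y
      · exact congrFun h2 ⟨y, hy⟩
      · obtain ⟨j, rfl⟩ := hP y hy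
        exact congrFun h1 j
    · rintro ⟨s, t⟩
      refine ⟨fun y => if hy : P y then t ⟨y, hy⟩ else s (hP y hy).choose, ?_⟩
      refine Prod.ext (funext fun j => ?_) (funext fun y => ?_)
      · have hj : ¬ P (x + ((j : ℕ) : ZMod L)) := fun H => H j j.2 rfl
        simp only [f, dif_neg hj]
        exact congrArg s (injective_add_offset hX x (hP _ hj).choose_spec)
      · simp [r, y.2]
  have heq : placeAt x g = Matrix.of fun σ τ => if r σ = r τ then g (f σ) (f τ) else 0 := by
    ext σ τ
    simp only [Matrix.of_apply]
    by_cases hστ : ∀ y : ZMod L, (∀ j ∈ X, y ≠ x + (j : ZMod L)) → σ y = τ y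
    · rw [placeAt_apply_of_agree g hστ, if_pos (funext fun y : {y // P y} => hστ y.1 y.2)]
    · rw [placeAt_apply_of_not_agree g hστ,
        if_neg fun H => hστ fun y hy => congrFun H ⟨y, hy⟩]
  rw [heq]
  exact expectation_tensor_one_le f r hfr g ψ

end Placement

/-! ### The twist of the ring and its effect on local terms. -/

section TwistOperator

variable {d L : ℕ} [NeZero L]

theorem stdAddChar_mul_star (a : ZMod L) :
    ZMod.stdAddChar a * star (ZMod.stdAddChar a) = (1 : ℂ) := by
  rw [ZMod.stdAddChar_apply, Complex.star_def, Complex.mul_conj]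
  simp

theorem star_stdAddChar (a : ZMod L) :
    star (ZMod.stdAddChar a : ℂ) = ZMod.stdAddChar (-a) := by
  have h : (ZMod.stdAddChar (-a) : ℂ) * ZMod.stdAddChar a = 1 := by
    rw [← AddChar.map_add_eq_mul, neg_add_cancel, AddChar.map_zero_eq_one]
  calc star (ZMod.stdAddChar a : ℂ)
      = ZMod.stdAddChar (-a) * ZMod.stdAddChar a * star (ZMod.stdAddChar a) := by rw [h, one_mul]
    _ = ZMod.stdAddChar (-a) := by rw [mul_assoc, stdAddChar_mul_star, mul_one]

/-- The kernel of a twist by a phase depends only on the phase differences. -/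
theorem twistKernel_stdAddChar {ι : Type*} (φ : ι → ZMod L) (i j : ι) :
    twistKernel (fun k => (ZMod.stdAddChar (φ k) : ℂ)) i j =
      ZMod.stdAddChar (-(φ i - φ j)) + ZMod.stdAddChar (φ i - φ j) - 2 := by
  simp only [twistKernel, Matrix.of_apply, star_stdAddChar, ← AddChar.map_add_eq_mul]
  congr 3 <;> ring

/-- The dipole moment `∑ j, j * σ j` modulo `L`. -/
def dipole (σ : Config d L) : ZMod L := ∑ j, j * ((σ j : ℕ) : ZMod L)

/-- The diagonal entries of the operator twisting the chain `n` times about the `z`-axis. -/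
noncomputable def twist (n : ℕ) (σ : Config d L) : ℂ := ZMod.stdAddChar ((n : ZMod L) * dipole σ)

theorem dipole_translate (σ : Config d L) :
    dipole (fun j => σ (j - 1)) = dipole σ + ((∑ j, (σ j : ℕ) : ℕ) : ZMod L) := by
  simp only [dipole]
  rw [← Equiv.sum_comp (Equiv.addRight (1 : ZMod L))]
  push_cast
  rw [← Finset.sum_add_distrib]
  refine Finset.sum_congr rfl fun j _ => ?_
  simp
  ring

/-- Spin conservation removes the position `x` from the dipole difference, so only offsets within
`X` enter the phase. This makes the effective phases small for every placement, including across the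
seam of the ring. -/
theorem hadamard_placeAt_twistKernel {X : Finset ℕ} (hX : X ⊆ Finset.range L)
    {h : Matrix (X → Fin (d + 1)) (X → Fin (d + 1)) ℂ}
    (hc : ∀ s t, h s t ≠ 0 → ∑ j, (s j : ℕ) = ∑ j, (t j : ℕ)) (x : ZMod L) (n : ℕ) :
    (placeAt x h).hadamard (twistKernel (twist n)) =
      placeAt x (h.hadamard (twistKernel fun s =>
        ZMod.stdAddChar (((n * ∑ j : X, (j : ℕ) * (s j : ℕ) : ℕ)) : ZMod L))) := by
  ext σ τ
  rw [Matrix.hadamard_apply]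
  by_cases hστ : ∀ y : ZMod L, (∀ j ∈ X, y ≠ x + (j : ZMod L)) → σ y = τ y
  · rw [placeAt_apply_of_agree _ hστ, placeAt_apply_of_agree _ hστ, Matrix.hadamard_apply]
    set s : X → Fin (d + 1) := fun j => σ (x + ((j : ℕ) : ZMod L)) with hs
    set t : X → Fin (d + 1) := fun j => τ (x + ((j : ℕ) : ZMod L)) with ht
    -- The two kernels need agree only at nonzero entries of `h`, where spin is conserved.
    by_cases h0 : h s t = 0
    · simp [h0]
    · congr 1
      have hdip : dipole σ - dipole τ =
          ((∑ j : X, (j : ℕ) * (s j : ℕ) : ℕ) : ZMod L) - ((∑ j : X, (j : ℕ) * (t j : ℕ) : ℕ) : ZMod L) := by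
        have h1 := congrArg (Nat.cast : ℕ → ZMod L) (hc _ _ h0)
        simp only [dipole]
        rw [sum_sub_sum_of_agree hX hστ fun y s => y * ((s : ℕ) : ZMod L)]
        push_cast at h1 ⊢
        have h2 : ∀ j : X, (x + ((j : ℕ) : ZMod L)) * ((s j : ℕ) : ZMod L) -
            (x + ((j : ℕ) : ZMod L)) * ((t j : ℕ) : ZMod L) =
            x * ((s j : ℕ) : ZMod L) - x * ((t j : ℕ) : ZMod L) +
              (((j : ℕ) : ZMod L) * ((s j : ℕ) : ZMod L) -
                ((j : ℕ) : ZMod L) * ((t j : ℕ) : ZMod L)) := fun j => by ring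
        rw [Finset.sum_congr rfl fun j _ => h2 j, Finset.sum_add_distrib,
          Finset.sum_sub_distrib, Finset.sum_sub_distrib, ← Finset.mul_sum, ← Finset.mul_sum, h1]
        ring
      have hphase : (n : ZMod L) * dipole σ - (n : ZMod L) * dipole τ =
          ((n * ∑ j : X, (j : ℕ) * (s j : ℕ) : ℕ) : ZMod L) -
            ((n * ∑ j : X, (j : ℕ) * (t j : ℕ) : ℕ) : ZMod L) := by
        rw [← mul_sub, hdip]
        push_cast
        ring
      unfold twist
      rw [twistKernel_stdAddChar, twistKernel_stdAddChar, hphase]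
  · rw [placeAt_apply_of_not_agree _ hστ, placeAt_apply_of_not_agree _ hστ, zero_mul]

theorem norm_stdAddChar_natCast_sub_one_le (N : ℕ) :
    ‖(ZMod.stdAddChar ((N : ℕ) : ZMod L) : ℂ) - 1‖ ≤ 2 * Real.pi * N / L := by
  have h := ZMod.stdAddChar_coe (N := L) (N : ℤ)
  push_cast at h
  have h2 := Real.norm_exp_I_mul_ofReal_sub_one_le (x := 2 * Real.pi * N / L)
  rw [h]
  rw [Real.norm_of_nonneg (by positivity)] at h2
  convert h2 using 5
  push_cast
  ring

theorem sum_offset_mul_le {X : Finset ℕ} (s : X → Fin (d + 1)) :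
    ∑ j : X, (j : ℕ) * (s j : ℕ) ≤ d * (X.card * X.sup id) := by
  calc ∑ j : X, (j : ℕ) * (s j : ℕ) ≤ ∑ _j : X, X.sup id * d := by
        refine Finset.sum_le_sum fun j _ => ?_
        exact Nat.mul_le_mul (Finset.le_sup (f := id) j.2) (Nat.lt_succ_iff.1 (s j).2)
    _ = d * (X.card * X.sup id) := by simp; ring

theorem expectation_hadamard_placeAt_le {X : Finset ℕ} (hX : X ⊆ Finset.range L)
    {h : Matrix (X → Fin (d + 1)) (X → Fin (d + 1)) ℂ}
    (hc : ∀ s t, h s t ≠ 0 → ∑ j, (s j : ℕ) = ∑ j, (t j : ℕ)) (x : ZMod L) (n : ℕ)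
    (ψ : Config d L → ℂ) :
    expectation ((placeAt x h).hadamard (twistKernel (twist n))) ψ ≤
      4 * (2 * Real.pi * n * d / L) ^ 2 * (((X.card : ℝ) * ((X.sup id : ℕ) : ℝ)) ^ 2 *
        ‖Matrix.toEuclideanCLM (n := X → Fin (d + 1)) (𝕜 := ℂ) h‖) * sqNorm ψ := by
  rw [hadamard_placeAt_twistKernel hX hc]
  refine (expectation_placeAt_le hX _ x ψ).trans ?_
  have hψ : 0 ≤ sqNorm ψ := Finset.sum_nonneg fun _ _ => by positivity
  gcongr
  refine (opNorm_hadamard_twistKernel_le (r := 2 * Real.pi * n * d / L * (X.card * (X.sup id : ℕ)))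
    h _ (fun s => stdAddChar_mul_star _) (by positivity) fun s => ?_).trans_eq (by ring)
  refine (norm_stdAddChar_natCast_sub_one_le _).trans ?_
  have : ((∑ j : X, (j : ℕ) * (s j : ℕ) : ℕ) : ℝ) ≤ d * (X.card * (X.sup id : ℕ)) := by
    exact_mod_cast sum_offset_mul_le s
  rw [Nat.cast_mul]
  calc 2 * Real.pi * (n * ((∑ j : X, (j : ℕ) * (s j : ℕ) : ℕ) : ℝ)) / L
      ≤ 2 * Real.pi * (n * (d * (X.card * (X.sup id : ℕ)))) / L := by gcongr
    _ = _ := by ring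

end TwistOperator

/-! ### Spin and momentum sectors under the twist. -/

section Sectors

variable {d L : ℕ} [NeZero L]

/-- The subspace with total spin `M` and wave number `q`. -/
def sector (d L : ℕ) [NeZero L] (M q : ℝ) : Submodule ℂ (Config d L → ℂ) where
  carrier := {ψ | InSector M q ψ}
  zero_mem' := ⟨fun σ h => absurd rfl h, by funext σ; simp [translateState]⟩
  add_mem' := by
    rintro ψ φ ⟨h1, h2⟩ ⟨h3, h4⟩
    refine ⟨fun σ hσ => ?_, ?_⟩
    · by_cases h : ψ σ = 0
      · exact h3 σ fun h' => hσ (by simp [h, h'])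
      · exact h1 σ h
    · rw [smul_add, ← h2, ← h4]
      rfl
  smul_mem' := by
    rintro c ψ ⟨h1, h2⟩
    refine ⟨fun σ hσ => h1 σ fun h => hσ (by simp [h]), ?_⟩
    rw [smul_comm, ← h2]
    rfl

/-- The translation of basis states by one site. -/
def translateConfig (d L : ℕ) : Config d L ≃ Config d L where
  toFun σ := fun j => σ (j - 1)
  invFun σ := fun j => σ (j + 1)
  left_inv σ := by simp
  right_inv σ := by simp

theorem mulVec_mem_sector {A : Matrix (Config d L) (Config d L) ℂ}
    (hA : ∀ σ τ : Config d L, A (fun j => σ (j - 1)) (fun j => τ (j - 1)) = A σ τ)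
    (hc : ∀ σ τ, A σ τ ≠ 0 → totalSpinZ σ = totalSpinZ τ) {M q : ℝ} :
    ∀ ψ ∈ sector d L M q, A.mulVec ψ ∈ sector d L M q := by
  rintro ψ ⟨h1, h2⟩
  refine ⟨fun σ hσ => ?_, ?_⟩
  · obtain ⟨τ, -, hτ⟩ := Finset.exists_ne_zero_of_sum_ne_zero hσ
    rw [hc σ τ (left_ne_zero_of_mul hτ), h1 τ (right_ne_zero_of_mul hτ)]
  · rw [← Matrix.mulVec_smul, ← h2]
    funext σ
    exact (Equiv.sum_comp (translateConfig d L)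
      (fun τ => A (fun j => σ (j - 1)) τ * ψ τ)).symm.trans
      (Finset.sum_congr rfl fun τ _ => congrArg (· * ψ (fun j => τ (j - 1))) (hA σ τ))

/-- This is why the chain is twisted `n` times: the fractional filling `m / n` contributes `m L`,
which vanishes modulo `L`. -/
theorem mul_sum_eq_of_totalSpinZ_eq_sectorSpin {m : ℤ} {n : ℕ} (hn : 1 ≤ n) {δ : ℤ}
    {σ : Config d L} (h : totalSpinZ σ = sectorSpin d m n L δ) :
    (n : ZMod L) * ((∑ j, (σ j : ℕ) : ℕ) : ZMod L) = ((-(n * δ) : ℤ) : ZMod L) := by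
  have hn' : (n : ℝ) ≠ 0 := by positivity
  have h1 : (n : ℝ) * ((∑ j, (σ j : ℕ) : ℕ) : ℝ) = m * L - n * δ := by
    rw [totalSpinZ_eq, sectorSpin] at h
    have h2 : ((∑ j, (σ j : ℕ) : ℕ) : ℝ) = (m : ℝ) / n * L - δ := by linarith
    rw [h2]
    field_simp
  have h3 : (n : ℤ) * ((∑ j, (σ j : ℕ) : ℕ) : ℤ) = m * L - n * δ := by exact_mod_cast h1
  have h4 := congrArg (Int.cast : ℤ → ZMod L) h3
  push_cast at h4 ⊢
  rw [h4, ZMod.natCast_self]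
  ring

theorem stdAddChar_mul_exp (p k : ℤ) :
    (ZMod.stdAddChar ((k : ℤ) : ZMod L) : ℂ) *
        Complex.exp (Complex.I * ((2 * Real.pi * (p : ℝ) / (L : ℝ) : ℝ) : ℂ)) =
      Complex.exp (Complex.I * ((2 * Real.pi * ((p + k : ℤ) : ℝ) / (L : ℝ) : ℝ) : ℂ)) := by
  rw [ZMod.stdAddChar_coe, ← Complex.exp_add]
  congr 1
  push_cast
  ring

theorem twist_translate {m : ℤ} {n : ℕ} (hn : 1 ≤ n) {δ : ℤ} {σ : Config d L}
    (h : totalSpinZ σ = sectorSpin d m n L δ) :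
    twist n (fun j => σ (j - 1)) = twist n σ * ZMod.stdAddChar ((-(n * δ) : ℤ) : ZMod L) := by
  rw [twist, dipole_translate, mul_add, mul_sum_eq_of_totalSpinZ_eq_sectorSpin hn h,
    AddChar.map_add_eq_mul, twist]

theorem mul_mem_sector {M : ℝ} {p k : ℤ} {u ψ : Config d L → ℂ}
    (hu : ∀ σ, totalSpinZ σ = M →
      u (fun j => σ (j - 1)) = u σ * ZMod.stdAddChar ((k : ℤ) : ZMod L))
    (hψ : ψ ∈ sector d L M (2 * Real.pi * (p : ℝ) / (L : ℝ))) :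
    u * ψ ∈ sector d L M (2 * Real.pi * ((p + k : ℤ) : ℝ) / (L : ℝ)) := by
  obtain ⟨h1, h2⟩ := hψ
  refine ⟨fun σ hσ => h1 σ (right_ne_zero_of_mul hσ), funext fun σ => ?_⟩
  have h3 := congrFun h2 σ
  simp only [translateState, Pi.smul_apply, smul_eq_mul, Pi.mul_apply] at h3 ⊢
  rw [h3]
  by_cases h0 : ψ σ = 0
  · simp [h0]
  · rw [hu σ (h1 σ h0), ← stdAddChar_mul_exp]
    ring

theorem twist_mul_mem_sector {m : ℤ} {n : ℕ} (hn : 1 ≤ n) {δ p : ℤ} {ψ : Config d L → ℂ}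
    (hψ : ψ ∈ sector d L (sectorSpin d m n L δ) (2 * Real.pi * (p : ℝ) / (L : ℝ))) :
    twist n * ψ ∈
      sector d L (sectorSpin d m n L δ) (2 * Real.pi * ((p - n * δ : ℤ) : ℝ) / (L : ℝ)) :=
  mul_mem_sector (fun _ h => twist_translate hn h) hψ

theorem star_twist_mul_mem_sector {m : ℤ} {n : ℕ} (hn : 1 ≤ n) {δ p : ℤ} {ψ : Config d L → ℂ}
    (hψ : ψ ∈ sector d L (sectorSpin d m n L δ) (2 * Real.pi * (p : ℝ) / (L : ℝ))) :
    star (twist n) * ψ ∈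
      sector d L (sectorSpin d m n L δ) (2 * Real.pi * ((p + n * δ : ℤ) : ℝ) / (L : ℝ)) :=
  mul_mem_sector (fun σ h => by
    rw [Pi.star_apply, Pi.star_apply, twist_translate hn h, star_mul', star_stdAddChar,
      ← Int.cast_neg, neg_neg]) hψ

theorem twist_mul_star (n : ℕ) (σ : Config d L) : twist n σ * star (twist n σ) = 1 :=
  stdAddChar_mul_star _

theorem norm_twist (n : ℕ) (σ : Config d L) : ‖twist n σ‖ = 1 := by
  rw [twist, ZMod.stdAddChar_apply]
  exact Circle.norm_coe _

theorem sqNorm_twist_mul (n : ℕ) (ψ : Config d L → ℂ) : sqNorm (twist n * ψ) = sqNorm ψ := by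
  simp [sqNorm, norm_twist]

theorem sqNorm_star_twist_mul (n : ℕ) (ψ : Config d L → ℂ) :
    sqNorm (star (twist n) * ψ) = sqNorm ψ := by
  simp [sqNorm, norm_twist]

/-- Twists are norm-preserving maps between the sectors, so a nonzero state in one gives a nonzero
state in the other. -/
theorem sector_empty_of_twist {m : ℤ} {n : ℕ} (hn : 1 ≤ n) {δ p : ℤ}
    (h : ∀ ψ ∈ sector d L (sectorSpin d m n L δ) (2 * Real.pi * (p : ℝ) / (L : ℝ)), ψ = 0) (k : ℤ)
    (hk : k = p + n * δ ∨ k = p - n * δ) :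
    ∀ ψ ∈ sector d L (sectorSpin d m n L δ) (2 * Real.pi * (k : ℝ) / (L : ℝ)), ψ = 0 := by
  intro ψ hψ
  by_contra h0
  have hpos := sqNorm_pos h0
  rcases hk with rfl | rfl
  · have h1 := twist_mul_mem_sector hn hψ
    rw [add_sub_cancel_right] at h1
    rw [← sqNorm_twist_mul n, h _ h1] at hpos
    simp [sqNorm] at hpos
  · have h1 := star_twist_mul_mem_sector hn hψ
    rw [sub_add_cancel] at h1
    rw [← sqNorm_star_twist_mul n, h _ h1] at hpos
    simp [sqNorm] at hpos

end Sectors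

/-! ### Symmetries, spectrum and semiconcavity of the chain. -/

section Hamiltonian

variable {d : ℕ} (H : SpinChain d) (L : ℕ) [NeZero L]

theorem SpinChain.hamiltonian_isHermitian : (H.hamiltonian L).IsHermitian := by
  classical
  unfold SpinChain.hamiltonian
  refine Matrix.IsHermitian.add ?_ ?_
  · refine Matrix.isHermitian_diagonal_of_self_adjoint _ ?_
    funext σ
    simp
  · unfold Matrix.IsHermitian
    simp only [Matrix.conjTranspose_sum]
    exact Finset.sum_congr rfl fun X _ => Finset.sum_congr rfl fun x _ =>
      placeAt_isHermitian (H.term_isHermitian L X) x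

theorem SpinChain.hamiltonian_translate (σ τ : Config d L) :
    H.hamiltonian L (fun j => σ (j - 1)) (fun j => τ (j - 1)) = H.hamiltonian L σ τ := by
  unfold SpinChain.hamiltonian
  simp only [Matrix.add_apply, Matrix.sum_apply, placeAt_translate]
  congr 1
  · have hinj : (fun j => σ (j - 1)) = (fun j => τ (j - 1)) ↔ σ = τ := by
      refine ⟨fun h => funext fun j => ?_, fun h => by rw [h]⟩
      simpa using congrFun h (j + 1)
    by_cases h : σ = τ
    · subst h
      simp [H.diag_translate]
    · rw [Matrix.diagonal_apply_ne _ h, Matrix.diagonal_apply_ne _ (mt hinj.1 h)]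
  · exact Finset.sum_congr rfl fun X _ =>
      Equiv.sum_comp (Equiv.subRight (1 : ZMod L)) fun x => placeAt x (H.term L X) σ τ

theorem SpinChain.hamiltonian_conserves (σ τ : Config d L) (h : H.hamiltonian L σ τ ≠ 0) :
    totalSpinZ σ = totalSpinZ τ := by
  by_contra hne
  apply h
  unfold SpinChain.hamiltonian
  rw [Matrix.add_apply, Matrix.diagonal_apply_ne _ fun h => hne (by rw [h]), zero_add,
    Matrix.sum_apply]
  refine Finset.sum_eq_zero fun X hX => ?_
  rw [Matrix.sum_apply]
  refine Finset.sum_eq_zero fun x _ => ?_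
  by_contra h0
  exact hne (placeAt_conserves (Finset.mem_powerset.1 hX) (H.term_conserves L X) h0)

/-- The `L` translates of each term contribute `O(1/L²)` apiece, weighted exactly as in
`ShortRange`. -/
theorem SpinChain.expectation_twist_le (n : ℕ) {K : ℝ}
    (hK : ∑ X ∈ (Finset.range L).powerset, ((X.card : ℝ) * ((X.sup id : ℕ) : ℝ)) ^ 2 *
      ‖Matrix.toEuclideanCLM (n := X → Fin (d + 1)) (𝕜 := ℂ) (H.term L X)‖ ≤ K)
    (ψ : Config d L → ℂ) :
    expectation (H.hamiltonian L) (twist n * ψ) + expectation (H.hamiltonian L) (star (twist n) * ψ)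
        - 2 * expectation (H.hamiltonian L) ψ ≤
      4 * (2 * Real.pi * n * d) ^ 2 * K / L * sqNorm ψ := by
  have hψ : 0 ≤ sqNorm ψ := Finset.sum_nonneg fun _ _ => by positivity
  have hL : (L : ℝ) ≠ 0 := Nat.cast_ne_zero.2 (NeZero.ne L)
  have hdecomp : (H.hamiltonian L).hadamard (twistKernel (twist n)) =
      ∑ X ∈ (Finset.range L).powerset, ∑ x : ZMod L,
        (placeAt x (H.term L X)).hadamard (twistKernel (twist n)) := by
    ext σ τ
    simp only [SpinChain.hamiltonian, Matrix.hadamard_apply, Matrix.add_apply, Matrix.sum_apply,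
      add_mul, Finset.sum_mul]
    -- The longitudinal part drops out: the twist kernel vanishes on the diagonal.
    rw [add_eq_right]
    by_cases h : σ = τ
    · subst h
      have : twistKernel (twist n) σ σ = 0 := by
        simp only [twistKernel, Matrix.of_apply]
        linear_combination 2 * twist_mul_star n σ
      rw [this, mul_zero]
    · rw [Matrix.diagonal_apply_ne _ h, zero_mul]
  rw [expectation_twist, hdecomp, expectation_sum]
  simp only [expectation_sum]
  calc ∑ X ∈ (Finset.range L).powerset, ∑ x : ZMod L,
        expectation ((placeAt x (H.term L X)).hadamard (twistKernel (twist n))) ψ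
      ≤ ∑ X ∈ (Finset.range L).powerset, ∑ _x : ZMod L,
          4 * (2 * Real.pi * n * d / L) ^ 2 * (((X.card : ℝ) * ((X.sup id : ℕ) : ℝ)) ^ 2 *
            ‖Matrix.toEuclideanCLM (n := X → Fin (d + 1)) (𝕜 := ℂ) (H.term L X)‖) * sqNorm ψ :=
        Finset.sum_le_sum fun X hX => Finset.sum_le_sum fun x _ =>
          expectation_hadamard_placeAt_le (Finset.mem_powerset.1 hX) (H.term_conserves L X) x n ψ
    _ = 4 * (2 * Real.pi * n * d) ^ 2 / L * (∑ X ∈ (Finset.range L).powerset,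
          ((X.card : ℝ) * ((X.sup id : ℕ) : ℝ)) ^ 2 *
          ‖Matrix.toEuclideanCLM (n := X → Fin (d + 1)) (𝕜 := ℂ) (H.term L X)‖) * sqNorm ψ := by
        simp only [Finset.sum_const, Finset.card_univ, ZMod.card, nsmul_eq_mul, Finset.mul_sum,
          Finset.sum_mul]
        refine Finset.sum_congr rfl fun X _ => ?_
        field_simp
    _ ≤ 4 * (2 * Real.pi * n * d) ^ 2 / L * K * sqNorm ψ := by gcongr
    _ = _ := by ring

theorem SpinChain.energy_spec {M : ℝ} {p : ℤ}
    (hne : ∃ ψ ∈ sector d L M (2 * Real.pi * (p : ℝ) / (L : ℝ)), ψ ≠ 0) :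
    (∃ ψ ∈ sector d L M (2 * Real.pi * (p : ℝ) / (L : ℝ)), ψ ≠ 0 ∧
      (H.hamiltonian L).mulVec ψ = (H.energy L M p : ℂ) • ψ) ∧
    ∀ φ ∈ sector d L M (2 * Real.pi * (p : ℝ) / (L : ℝ)),
      H.energy L M p * sqNorm φ ≤ expectation (H.hamiltonian L) φ := by
  obtain ⟨E, hE, hlow⟩ := (H.hamiltonian_isHermitian L).exists_isLeast_eigenvalue
    (sector d L M (2 * Real.pi * (p : ℝ) / (L : ℝ)))
    (mulVec_mem_sector (H.hamiltonian_translate L) (H.hamiltonian_conserves L)) hne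
  have hEq : H.energy L M p = E := hE.csInf_eq
  rw [hEq]
  obtain ⟨ψ, h1, h2, h3⟩ := hE.1
  exact ⟨⟨ψ, h2, h1, h3⟩, hlow⟩

theorem SpinChain.energy_eq_zero_of_empty {M : ℝ} {p : ℤ}
    (h : ∀ ψ ∈ sector d L M (2 * Real.pi * (p : ℝ) / (L : ℝ)), ψ = 0) : H.energy L M p = 0 := by
  unfold SpinChain.energy lowestEnergy
  convert Real.sInf_empty
  ext E
  simp only [Set.mem_ofPred_eq, Set.mem_empty_iff_false, iff_false]
  rintro ⟨ψ, h1, h2, -⟩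
  exact h1 (h ψ h2)

/-- The lowest energy is semiconcave along the wave numbers connected by twists. -/
theorem SpinChain.energy_semiconcave {m : ℤ} {n : ℕ} (hn : 1 ≤ n) (δ : ℤ) {K : ℝ} (hK0 : 0 ≤ K)
    (hK : ∑ X ∈ (Finset.range L).powerset, ((X.card : ℝ) * ((X.sup id : ℕ) : ℝ)) ^ 2 *
      ‖Matrix.toEuclideanCLM (n := X → Fin (d + 1)) (𝕜 := ℂ) (H.term L X)‖ ≤ K) (p : ℤ) :
    H.energy L (sectorSpin d m n L δ) (p + n * δ) + H.energy L (sectorSpin d m n L δ) (p - n * δ)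
      - 2 * H.energy L (sectorSpin d m n L δ) p ≤ 4 * (2 * Real.pi * n * d) ^ 2 * K / L := by
  by_cases hne : ∃ ψ ∈ sector d L (sectorSpin d m n L δ) (2 * Real.pi * (p : ℝ) / (L : ℝ)), ψ ≠ 0
  · obtain ⟨⟨ψ, hψ, hψ0, hEψ⟩, -⟩ := H.energy_spec L hne
    have hpos := sqNorm_pos hψ0
    have hm := twist_mul_mem_sector hn hψ
    have hp := star_twist_mul_mem_sector hn hψ
    have nz : ∀ φ : Config d L → ℂ, sqNorm φ = sqNorm ψ → φ ≠ 0 := by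
      rintro φ h rfl
      rw [← h] at hpos
      simp [sqNorm] at hpos
    have h1 := (H.energy_spec L ⟨_, hm, nz _ (sqNorm_twist_mul n ψ)⟩).2 _ hm
    have h2 := (H.energy_spec L ⟨_, hp, nz _ (sqNorm_star_twist_mul n ψ)⟩).2 _ hp
    rw [sqNorm_twist_mul] at h1
    rw [sqNorm_star_twist_mul] at h2
    have h3 := H.expectation_twist_le L n hK ψ
    rw [expectation_of_eigenvector hEψ] at h3
    refine le_of_mul_le_mul_right ?_ hpos
    linarith
  -- If the sector is trivial, so are both neighbours, and all three energies take the default value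
  -- `sInf ∅ = 0`.
  · push Not at hne
    rw [H.energy_eq_zero_of_empty L hne,
      H.energy_eq_zero_of_empty L (sector_empty_of_twist hn hne _ (Or.inl rfl)),
      H.energy_eq_zero_of_empty L (sector_empty_of_twist hn hne _ (Or.inr rfl))]
    simp only [add_zero, mul_zero, sub_zero]
    positivity

theorem SpinChain.energy_add_length (M : ℝ) (p : ℤ) : H.energy L M (p + L) = H.energy L M p := by
  have h := stdAddChar_mul_exp (L := L) p L
  rw [Int.cast_natCast, ZMod.natCast_self, AddChar.map_zero_eq_one, one_mul] at h
  simp only [SpinChain.energy, lowestEnergy, InSector, h]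

theorem SpinChain.energy_emod (M : ℝ) (p : ℤ) : H.energy L M (p % L) = H.energy L M p := by
  have : Function.Periodic (H.energy L M) (L : ℤ) := H.energy_add_length L M
  rw [Int.emod_def, mul_comm]
  exact this.sub_int_mul_eq (p / L)

theorem SpinChain.exists_abs_energy_le (M : ℝ) : ∃ B : ℝ, ∀ p, |H.energy L M p| ≤ B := by
  refine ⟨∑ k ∈ Finset.Ico 0 (L : ℤ), |H.energy L M k|, fun p => ?_⟩
  have hL : (0 : ℤ) < L := Int.natCast_pos.2 (NeZero.pos L)
  rw [← H.energy_emod L M p]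
  exact Finset.single_le_sum (f := fun k => |H.energy L M k|) (fun _ _ => abs_nonneg _)
    (Finset.mem_Ico.2 ⟨Int.emod_nonneg _ hL.ne', Int.emod_lt_of_pos _ hL⟩)

end Hamiltonian

/-! ### Uniform limits of step functions. -/

section Continuity

theorem exists_floor_locally_const {l : ℝ} (hl : 0 < l) (a x : ℝ) :
    ∃ ρ > 0, ∃ k : ℤ, (∀ y, x ≤ y → y < x + ρ → ⌊y * l + a⌋ = ⌊x * l + a⌋) ∧
      ∀ y, x - ρ < y → y < x → ⌊y * l + a⌋ = k := by
  set z := x * l + a with hz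
  have h1 : 0 < (⌊z⌋ + 1 - z) / l := div_pos (by linarith [Int.lt_floor_add_one z]) hl
  have h2 : 0 < (z - (⌈z⌉ - 1)) / l := div_pos (by linarith [Int.ceil_lt_add_one z]) hl
  -- `⌈z⌉ - 1` is the left limit of the floor at `z`, also when `z` is an integer.
  refine ⟨_, lt_min h1 h2, ⌈z⌉ - 1, fun y hy hy' => ?_, fun y hy hy' => ?_⟩
  · have h3 : y - x < (⌊z⌋ + 1 - z) / l := by
      linarith [min_le_left ((⌊z⌋ + 1 - z) / l) ((z - (⌈z⌉ - 1)) / l)]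
    rw [lt_div_iff₀ hl] at h3
    rw [Int.floor_eq_iff]
    constructor <;> nlinarith [Int.floor_le z]
  · have h3 : x - y < (z - (⌈z⌉ - 1)) / l := by
      linarith [min_le_right ((⌊z⌋ + 1 - z) / l) ((z - (⌈z⌉ - 1)) / l)]
    rw [lt_div_iff₀ hl] at h3
    rw [Int.floor_eq_iff]
    push_cast
    constructor <;> nlinarith [Int.le_ceil z]

/-- A uniform limit of step functions on ever finer grids is continuous if the variation of the
functions over some shift, which becomes small on the scale of the real line, tends to zero. -/
theorem continuous_of_tendstoUniformly_floor {F : ℕ → ℤ → ℝ} {l a : ℕ → ℝ} {s : ℕ → ℤ}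
    {e : ℝ → ℝ} (hl : ∀ i, 0 < l i) (hs : ∀ i, s i ≠ 0)
    (hsl : Filter.Tendsto (fun i => (s i : ℝ) / l i) Filter.atTop (nhds 0))
    (hF : ∀ ε > 0, ∀ᶠ i in Filter.atTop, ∀ p, |F i (p + s i) - F i p| ≤ ε)
    (he : TendstoUniformly (fun i q => F i ⌊q * l i + a i⌋) e Filter.atTop) : Continuous e := by
  rw [Metric.continuous_iff]
  intro x ε hε
  -- The budget is `2 + 3 + 2`: oscillation left of `x`, the crossing by a shift, oscillation right
  -- of `x`.
  have hη : 0 < ε / 7 := by positivity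
  have hev := Metric.tendstoUniformly_iff.1 he _ hη
  simp only [Real.dist_eq] at hev
  obtain ⟨i, hi⟩ := hev.exists
  obtain ⟨ρ, hρ, k, hright, hleft⟩ := exists_floor_locally_const (hl i) (a i) x
  have hR : ∀ y, x ≤ y → y < x + ρ → |e y - e x| < 2 * (ε / 7) := by
    intro y hy hy'
    have h1 := hi y
    have h2 := hi x
    rw [hright y hy hy'] at h1
    rw [abs_lt] at h1 h2 ⊢
    constructor <;> linarith [h1.1, h1.2, h2.1, h2.2]
  have hLft : ∀ y z, x - ρ < y → y < x → x - ρ < z → z < x → |e y - e z| < 2 * (ε / 7) := by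
    intro y z hy hy' hz hz'
    have h1 := hi y
    have h2 := hi z
    rw [hleft y hy hy'] at h1
    rw [hleft z hz hz'] at h2
    rw [abs_lt] at h1 h2 ⊢
    constructor <;> linarith [h1.1, h1.2, h2.1, h2.2]
  have hsmall := Metric.tendsto_nhds.1 hsl ρ hρ
  obtain ⟨j, ⟨hj, hjF⟩, hjs⟩ := ((hev.and (hF _ hη)).and hsmall).exists
  rw [Real.dist_eq, sub_zero] at hjs
  set t := (s j : ℝ) / l j with ht
  have ht0 : t ≠ 0 := div_ne_zero (Int.cast_ne_zero.2 (hs j)) (hl j).ne'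
  have htl : t * l j = s j := div_mul_cancel₀ _ (hl j).ne'
  -- The shift `t` is a whole number of grid steps, so it commutes with the floor.
  have hfl : ∀ y, ⌊(y + t) * l j + a j⌋ = ⌊y * l j + a j⌋ + s j := by
    intro y
    rw [← Int.floor_add_intCast]
    congr 1
    linear_combination htl
  have hstep : ∀ y, |e (y + t) - e y| < 3 * (ε / 7) := by
    intro y
    have h1 := hj (y + t)
    have h2 := hj y
    have h3 := hjF ⌊y * l j + a j⌋
    rw [hfl] at h1
    rw [abs_lt] at h1 h2 ⊢
    rw [abs_le] at h3
    constructor <;> linarith [h1.1, h1.2, h2.1, h2.2, h3.1, h3.2]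
  have htpos : 0 < |t| := abs_pos.2 ht0
  have hcross : |e (x + |t| / 2) - e (x - |t| / 2)| < 3 * (ε / 7) := by
    rcases abs_cases t with ⟨h, -⟩ | ⟨h, -⟩
    · have := hstep (x - |t| / 2)
      rwa [show x - |t| / 2 + t = x + |t| / 2 by linarith] at this
    · have := hstep (x + |t| / 2)
      rwa [show x + |t| / 2 + t = x - |t| / 2 by linarith, abs_sub_comm] at this
  refine ⟨ρ, hρ, fun y hy => ?_⟩
  rw [Real.dist_eq] at hy ⊢
  rw [abs_lt] at hy
  rcases le_or_gt x y with hxy | hxy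
  · linarith [hR y hxy (by linarith)]
  · have h1 := hLft y (x - |t| / 2) (by linarith) hxy (by linarith) (by linarith)
    have h2 := hR (x + |t| / 2) (by linarith) (by linarith)
    rw [abs_lt] at h1 h2 hcross ⊢
    constructor <;> linarith [h1.1, h1.2, h2.1, h2.2, hcross.1, hcross.2]

/-- A uniformly convergent sequence of bounded step functions is eventually uniformly bounded. -/
theorem exists_bound_of_tendstoUniformly_floor {F : ℕ → ℤ → ℝ} {l a : ℕ → ℝ} {e : ℝ → ℝ}
    (hl : ∀ i, 0 < l i) (hB : ∀ i, ∃ B, ∀ p, |F i p| ≤ B)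
    (he : TendstoUniformly (fun i q => F i ⌊q * l i + a i⌋) e Filter.atTop) :
    ∃ B, ∀ᶠ i in Filter.atTop, ∀ p, |F i p| ≤ B := by
  have hev := Metric.tendstoUniformly_iff.1 he 1 one_pos
  simp only [Real.dist_eq] at hev
  obtain ⟨i, hi⟩ := hev.exists
  obtain ⟨B, hB⟩ := hB i
  refine ⟨B + 2, hev.mono fun j hj p => ?_⟩
  -- At this point the argument of the `j`-th floor is exactly `p`.
  have h1 := hj ((p - a j) / l j)
  have h2 := hi ((p - a j) / l j)
  have h3 := hB ⌊(p - a j) / l j * l i + a i⌋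
  rw [div_mul_cancel₀ _ (hl j).ne', sub_add_cancel, Int.floor_intCast] at h1
  rw [abs_lt] at h1 h2
  rw [abs_le] at h3 ⊢
  constructor <;> linarith [h1.1, h1.2, h2.1, h2.2, h3.1, h3.2]

end Continuity

/-! ### The two continuity statements. -/

theorem SpinChain.exists_energy_shift_sq_le {d : ℕ} (H : SpinChain d) (hH : H.ShortRange)
    (m : ℤ) {n : ℕ} (hn : 1 ≤ n) :
    ∃ C : ℝ, ∀ (L : ℕ) [NeZero L] (δ : ℤ) (W : ℝ),
      (∀ p p' : ℤ, H.energy L (sectorSpin d m n L δ) p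
        - H.energy L (sectorSpin d m n L δ) p' ≤ W) →
      ∀ p : ℤ, (H.energy L (sectorSpin d m n L δ) (p + (n : ℤ) * δ)
        - H.energy L (sectorSpin d m n L δ) p) ^ 2 ≤ C * W / (L : ℝ) := by
  obtain ⟨K, hK⟩ := hH
  -- The `+ 1` keeps the curvature bound positive even if `K = 0`.
  refine ⟨2 * (4 * (2 * Real.pi * n * d) ^ 2 * |K| + 1), fun L _ δ W hW p => ?_⟩
  have hL : (0 : ℝ) < L := Nat.cast_pos.2 (NeZero.pos L)
  have h := increment_sq_le_of_semiconcave
    (a := fun k : ℤ => H.energy L (sectorSpin d m n L δ) (p + k * (n * δ))) (W := W)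
    (c := (4 * (2 * Real.pi * n * d) ^ 2 * |K| + 1) / L) (by positivity) (fun k => by
      have := H.energy_semiconcave L (m := m) hn δ (abs_nonneg K) ((hK L).trans (le_abs_self K))
        (p + k * (n * δ))
      rw [show p + (k + 1) * (n * δ) = p + k * (n * δ) + n * δ by ring,
        show p + (k - 1) * (n * δ) = p + k * (n * δ) - n * δ by ring]
      refine this.trans ?_
      gcongr
      linarith) (fun k l => hW _ _)
  simp only [one_mul, zero_mul, add_zero] at h
  exact h.trans_eq (by ring)

theorem theorem3 (d : ℕ) (hd : 1 ≤ d) (H : SpinChain d) (hH : H.ShortRange)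
    (m : ℤ) (n : ℕ) (hn : 1 ≤ n) (hmn : IsCoprime m (n : ℤ)) :
    (∃ C : ℝ, ∀ (L : ℕ) [NeZero L] (δ : ℤ), n ∣ L → δ ≠ 0 →
      |sectorSpin d m n L δ| < (d : ℝ) / 2 * (L : ℝ) →
      ∀ W : ℝ,
        (∀ p p' : ℤ, H.energy L (sectorSpin d m n L δ) p
          - H.energy L (sectorSpin d m n L δ) p' ≤ W) →
        ∀ p : ℤ, (H.energy L (sectorSpin d m n L δ) (p + (n : ℤ) * δ)
          - H.energy L (sectorSpin d m n L δ) p) ^ 2 ≤ C * W / (L : ℝ)) ∧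
    (∀ (L : ℕ → ℕ) [∀ i, NeZero (L i)] (δ : ℕ → ℤ) (c a : ℕ → ℝ) (e : ℝ → ℝ),
      Filter.Tendsto L Filter.atTop Filter.atTop →
      (∀ i, n ∣ L i) →
      (∀ i, δ i ≠ 0) →
      Filter.Tendsto (fun i => (δ i : ℝ) / (L i : ℝ)) Filter.atTop (nhds 0) →
      (∀ i, |sectorSpin d m n (L i) (δ i)| < (d : ℝ) / 2 * (L i : ℝ)) →
      (∀ i, a i ∈ Set.Icc (0 : ℝ) 1) →
      TendstoUniformly
        (fun (i : ℕ) (q : ℝ) =>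
          H.energy (L i) (sectorSpin d m n (L i) (δ i))
            ⌊q * (L i : ℝ) / (2 * Real.pi) + a i⌋ - c i)
        e Filter.atTop →
      Continuous e) := by
  obtain ⟨C, hC⟩ := H.exists_energy_shift_sq_le hH m hn
  refine ⟨⟨C, fun L _ δ _ _ _ W hW p => hC L δ W hW p⟩, ?_⟩
  intro L _ δ c a e hL _ hδ hδL _ _ he
  have hLpos : ∀ i, (0 : ℝ) < L i := fun i => Nat.cast_pos.2 (NeZero.pos (L i))
  have hl : ∀ i, 0 < (L i : ℝ) / (2 * Real.pi) := fun i => div_pos (hLpos i) Real.two_pi_pos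
  simp only [mul_div_assoc] at he
  obtain ⟨B, hB⟩ := exists_bound_of_tendstoUniformly_floor
    (F := fun i p => H.energy (L i) (sectorSpin d m n (L i) (δ i)) p - c i) hl (fun i => by
      obtain ⟨B, hB⟩ := H.exists_abs_energy_le (L i) (sectorSpin d m n (L i) (δ i))
      exact ⟨B + |c i|, fun p => (abs_sub _ _).trans (by linarith [hB p])⟩) he
  refine continuous_of_tendstoUniformly_floor
    (F := fun i p => H.energy (L i) (sectorSpin d m n (L i) (δ i)) p - c i)
    (s := fun i => (n : ℤ) * δ i) hl (fun i => mul_ne_zero (by positivity) (hδ i)) ?_ ?_ he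
  · have := hδL.const_mul (2 * Real.pi * n)
    rw [mul_zero] at this
    refine this.congr fun i => ?_
    push_cast
    field_simp
  · intro ε hε
    have hlim : Filter.Tendsto (fun i => C * (2 * B) / (L i : ℝ)) Filter.atTop (nhds 0) :=
      (tendsto_natCast_atTop_atTop.comp hL).const_div_atTop _
    filter_upwards [hB, hlim.eventually_lt_const (show (0 : ℝ) < ε ^ 2 by positivity)]
      with i hBi hi p
    -- The uniform bound `B` on the shifted curves makes `W = 2 * B` independent of `i`; the offsets
    -- `c i` cancel in differences.
    have h := hC (L i) (δ i) (2 * B) (fun p p' => by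
      have h1 := abs_le.1 (hBi p)
      have h2 := abs_le.1 (hBi p')
      linarith [h1.2, h2.1]) p
    rw [sub_sub_sub_cancel_right]
    exact abs_le_of_sq_le_sq (h.trans hi.le) hε.le
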